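/- Theorem (Open Mapping Theorem). Let $\mathbb{H}$ be the real algebra of quaternions, let $\mathbb{S}=\{q\in\mathbb{H} : q^2=-1\}$ be the sphere of imaginary units, and for $I\in\mathbb{S}$ let $L_I=\mathbb{R}+I\mathbb{R}$, identified with $\mathbb{C}$. For $x,y\in\mathbb{R}$ write $x+y\mathbb{S}=\{x+yJ : J\in\mathbb{S}\}$. A domain is a nonempty connected open set. Let $\Omega\subseteq\mathbb{H}$ be a symmetric slice domain; that is, $\Omega$ is a domain of $\mathbb{H}$ which intersects the real axis, the slice $\Omega_I=\Omega\cap L_I$ is a domain in $L_I$ for every $I\in\mathbb{S}$, and, whenever $x+yI\in\Omega$ with $x,y\in\mathbb{R}$ and $I\in\mathbb{S}$, the whole set $x+y\mathbb{S}$ is contained in $\Omega$. Let $f:\Omega\to\mathbb{H}$ be (slice) regular; that is, for every $I\in\mathbb{S}$ the restriction $f_I=f|_{\Omega_I}$ is of class $C^1$ and $$\frac12\left(\frac{\partial}{\partial x}+I\frac{\partial}{\partial y}\right)f_I(x+Iy)=0\qquad\text{for all } x+Iy\in\Omega_I .$$ Let $D_f\subseteq\Omega$ be the degenerate set of $f$,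 i.e. the union of all the 2-spheres $x+y\mathbb{S}\subseteq\Omega$ (with $x,y\in\mathbb{R}$, $y\neq0$) on which $f$ is constant, and let $\overline{D_f}$ be its closure. Then the restriction $f:\Omega\setminus\overline{D_f}\to\mathbb{H}$ is an open map, i.e. $f(U)$ is open in $\mathbb{H}$ for every open subset $U$ of $\Omega\setminus\overline{D_f}$. -/

import Mathlib

open scoped Quaternion

noncomputable section

namespace SliceRegular

/-- The two-sphere of quaternionic imaginary units. -/
def imagUnits : Set ℍ := {q | q ^ 2 = -1}

/-- The point `x + y I`, where `z = x + i y`. For an imaginary unit `I` this identifies the complex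
plane with the complex line `ℝ + I ℝ` in the quaternions. -/
def slicePoint (I : ℍ[ℝ]) (z : ℂ) : ℍ[ℝ] := (z.re : ℍ[ℝ]) + (z.im : ℍ[ℝ]) * I

/-- The slice of `Ω` by the complex line `ℝ + I ℝ`, read in the complex plane. -/
def slice (Ω : Set ℍ) (I : ℍ[ℝ]) : Set ℂ := {z | slicePoint I z ∈ Ω}

/-- The restriction of `f` to the complex line `ℝ + I ℝ`, read in the complex plane. -/
def sliceFun (f : ℍ[ℝ] → ℍ[ℝ]) (I : ℍ[ℝ]) : ℂ → ℍ[ℝ] := fun z => f (slicePoint I z)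

/-- The Cauchy-Riemann operator `(1/2) (∂/∂x + I ∂/∂y)` applied to the restriction of `f` to
`ℝ + I ℝ`, where `I` multiplies on the left. -/
def dbar (I : ℍ[ℝ]) (f : ℍ[ℝ] → ℍ[ℝ]) (z : ℂ) : ℍ[ℝ] :=
  (1 / 2 : ℝ) • (fderiv ℝ (sliceFun f I) z 1 + I * fderiv ℝ (sliceFun f I) z Complex.I)

/-- A domain: a nonempty connected open set. -/
def IsDomainSet {X : Type*} [TopologicalSpace X] (s : Set X) : Prop :=
  IsOpen s ∧ IsConnected s

/-- The function `f` is (slice) regular on `Ω`: its restriction to each slice of `Ω` is of class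
`C^1` and is annihilated by the Cauchy-Riemann operator of that slice. Only the values of `f` on
`Ω` matter when `Ω` is open. -/
def IsRegularOn (f : ℍ[ℝ] → ℍ[ℝ]) (Ω : Set ℍ) : Prop :=
  ∀ I ∈ imagUnits,
    ContDiffOn ℝ 1 (sliceFun f I) (slice Ω I) ∧ ∀ z ∈ slice Ω I, dbar I f z = 0

/-- A slice domain: a domain of the quaternions that meets the real axis and whose slices are all
domains of the corresponding complex lines. -/
def IsSliceDomain (Ω : Set ℍ) : Prop :=
  IsDomainSet Ω ∧ (∃ x : ℝ, (x : ℍ[ℝ]) ∈ Ω) ∧ ∀ I ∈ imagUnits, IsDomainSet (slice Ω I)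

/-- The set `x + y 𝕊`. -/
def sphere (x y : ℝ) : Set ℍ := {q | ∃ J ∈ imagUnits, q = (x : ℍ[ℝ]) + (y : ℍ[ℝ]) * J}

/-- Axial symmetry: with each point `x + y I` the set contains the whole sphere `x + y 𝕊`. -/
def IsSymmetric (C : Set ℍ) : Prop :=
  ∀ (x y : ℝ), ∀ I ∈ imagUnits, (x : ℍ[ℝ]) + (y : ℍ[ℝ]) * I ∈ C → sphere x y ⊆ C

/-- The degenerate set of a function `f` on `Ω`: the union of the spheres `x + y 𝕊` in `Ω`, with
`y ≠ 0`, on which `f` is constant. -/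
def degenerateSet (f : ℍ[ℝ] → ℍ[ℝ]) (Ω : Set ℍ) : Set ℍ :=
  {q | ∃ x y : ℝ, y ≠ 0 ∧ sphere x y ⊆ Ω ∧ (∃ c : ℍ[ℝ], ∀ p ∈ sphere x y, f p = c) ∧
    q ∈ sphere x y}

end SliceRegular

end

/-!
On the sphere of `z = x + iy` a regular function is affine in the imaginary unit,
`f (x + yJ) = α z + J β z`, and `α + iβ` is holomorphic in `z`. Hence `f` takes the value `w`
somewhere on the sphere of `z` exactly when the holomorphic function
`N_w = ‖α - w‖² - ‖β‖² + 2i⟪α - w, β⟫` vanishes at `z`. If `f` is not constant, the zeros of `N_w`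
are isolated and persist when `w` is perturbed (minimum modulus principle), so every `w` close to
`f (x + yI)` is attained on a sphere close to that of `x + yI`. Off the degenerate set `x + yI` is
the only point of its sphere where `f` has its value, and compactness of the sphere of imaginary
units forces the points at which `w` is attained to be close to `x + yI`.
-/

open Filter Topology Set ComplexConjugate
open scoped RealInnerProductSpace

namespace SliceRegular

/-! ### Imaginary units -/

theorem norm_eq_one_of_mem_imagUnits {I : ℍ[ℝ]} (hI : I ∈ imagUnits) : ‖I‖ = 1 := by
  have hsq : I ^ 2 = -1 := hI
  have : ‖I‖ ^ 2 = 1 := by rw [← norm_pow, hsq, norm_neg, norm_one]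
  exact (pow_eq_one_iff_of_nonneg (norm_nonneg I) two_ne_zero).1 this

theorem mem_imagUnits_iff {I : ℍ[ℝ]} : I ∈ imagUnits ↔ I.re = 0 ∧ ‖I‖ = 1 := by
  have sq_eq_iff (h : ‖I‖ = 1) : I ^ 2 = -1 ↔ I.re = 0 := by
    rw [← Quaternion.sq_eq_neg_normSq, Quaternion.normSq_eq_norm_mul_self, h, mul_one,
      Quaternion.coe_one]
  exact ⟨fun hI => ⟨(sq_eq_iff (norm_eq_one_of_mem_imagUnits hI)).1 hI,
    norm_eq_one_of_mem_imagUnits hI⟩, fun h => (sq_eq_iff h.2).2 h.1⟩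

theorem mul_mul_of_mem_imagUnits {I : ℍ[ℝ]} (hI : I ∈ imagUnits) (q : ℍ[ℝ]) :
    I * (I * q) = -q := by
  have hsq : I ^ 2 = -1 := hI
  rw [← mul_assoc, ← sq, hsq, neg_one_mul]

theorem neg_mem_imagUnits {I : ℍ[ℝ]} (hI : I ∈ imagUnits) : -I ∈ imagUnits :=
  (neg_sq I).trans hI

theorem imagUnits_nonempty : imagUnits.Nonempty := by
  refine ⟨((Complex.I : ℂ) : ℍ[ℝ]), ?_⟩
  change ((Complex.I : ℂ) : ℍ[ℝ]) ^ 2 = -1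
  rw [sq, ← Quaternion.coeComplex_mul, Complex.I_mul_I]
  ext <;> simp

theorem isCompact_imagUnits : IsCompact imagUnits :=
  (isCompact_sphere (0 : ℍ[ℝ]) 1).of_isClosed_subset
    (isClosed_eq (continuous_pow 2) continuous_const)
    fun _ hI => mem_sphere_zero_iff_norm.2 (norm_eq_one_of_mem_imagUnits hI)

theorem inner_mul_left_of_mem_imagUnits {I : ℍ[ℝ]} (hI : I ∈ imagUnits) (p q : ℍ[ℝ]) :
    ⟪I * p, q⟫ = -⟪p, I * q⟫ := by
  simp only [Quaternion.inner_def, Quaternion.re_mul, Quaternion.imI_mul, Quaternion.imJ_mul,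
    Quaternion.imK_mul, Quaternion.re_star, Quaternion.imI_star, Quaternion.imJ_star,
    Quaternion.imK_star, (mem_imagUnits_iff.1 hI).1]
  ring

theorem inner_mul_mul_of_mem_imagUnits {I : ℍ[ℝ]} (hI : I ∈ imagUnits) (p q : ℍ[ℝ]) :
    ⟪I * p, I * q⟫ = ⟪p, q⟫ := by
  rw [inner_mul_left_of_mem_imagUnits hI, mul_mul_of_mem_imagUnits hI, inner_neg_right, neg_neg]

theorem inner_mul_self_of_mem_imagUnits {I : ℍ[ℝ]} (hI : I ∈ imagUnits) (q : ℍ[ℝ]) :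
    ⟪I * q, q⟫ = 0 := by
  have h := inner_mul_left_of_mem_imagUnits hI q q
  rw [real_inner_comm (I * q)] at h
  linarith

theorem mul_inv_mem_imagUnits {b c : ℍ[ℝ]} (hc : c ≠ 0) (hnorm : ‖b‖ = ‖c‖) (horth : ⟪b, c⟫ = 0) :
    b * c⁻¹ ∈ imagUnits := by
  rw [mem_imagUnits_iff, norm_mul, norm_inv, hnorm, mul_inv_cancel₀ (norm_ne_zero_iff.2 hc)]
  have hinv : b * c⁻¹ = (Quaternion.normSq c)⁻¹ • (b * star c) := mul_smul_comm _ _ _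
  rw [Quaternion.inner_def] at horth
  rw [hinv, Quaternion.re_smul, horth, smul_zero]
  exact ⟨rfl, rfl⟩

/-! ### Points of a slice -/

theorem continuous_slicePoint : Continuous fun p : ℍ[ℝ] × ℂ => slicePoint p.1 p.2 := by
  have hcoe : Continuous ((↑) : ℝ → ℍ[ℝ]) := Quaternion.continuous_coe
  unfold slicePoint
  fun_prop

theorem slicePoint_conj (I : ℍ[ℝ]) (z : ℂ) : slicePoint I (conj z) = slicePoint (-I) z := by
  simp [slicePoint]

theorem slicePoint_of_im_eq_zero (I : ℍ[ℝ]) {z : ℂ} (hz : z.im = 0) : slicePoint I z = z.re := by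
  simp [slicePoint, hz]

theorem slicePoint_mem_sphere {I : ℍ[ℝ]} (hI : I ∈ imagUnits) (z : ℂ) :
    slicePoint I z ∈ sphere z.re z.im :=
  ⟨I, hI, rfl⟩

theorem exists_eq_slicePoint (q : ℍ[ℝ]) : ∃ I ∈ imagUnits, ∃ z : ℂ, q = slicePoint I z := by
  by_cases him : q.im = 0
  · obtain ⟨I, hI⟩ := imagUnits_nonempty
    refine ⟨I, hI, q.re, ?_⟩
    rw [slicePoint_of_im_eq_zero I (Complex.ofReal_im _), Complex.ofReal_re]
    simpa only [him, add_zero] using (Quaternion.re_add_im q).symm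
  · have hnorm : ‖q.im‖ ≠ 0 := norm_ne_zero_iff.2 him
    refine ⟨‖q.im‖⁻¹ • q.im, mem_imagUnits_iff.2 ⟨by simp, ?_⟩, ⟨q.re, ‖q.im‖⟩, ?_⟩
    · rw [norm_smul, norm_inv, norm_norm, inv_mul_cancel₀ hnorm]
    · rw [slicePoint, Quaternion.coe_mul_eq_smul, smul_inv_smul₀ hnorm, Quaternion.re_add_im]

section Symmetric

variable {Ω : Set ℍ[ℝ]} {I J : ℍ[ℝ]} {z : ℂ}

theorem isOpen_slice (hΩ : IsOpen Ω) (I : ℍ[ℝ]) : IsOpen (slice Ω I) :=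
  hΩ.preimage (continuous_slicePoint.comp (Continuous.prodMk_right I))

theorem IsSymmetric.slice_eq (hsymm : IsSymmetric Ω) (hI : I ∈ imagUnits) (hJ : J ∈ imagUnits) :
    slice Ω I = slice Ω J :=
  Subset.antisymm (fun z hz => hsymm z.re z.im I hI hz (slicePoint_mem_sphere hJ z))
    (fun z hz => hsymm z.re z.im J hJ hz (slicePoint_mem_sphere hI z))

theorem IsSymmetric.conj_mem_slice (hsymm : IsSymmetric Ω) (hI : I ∈ imagUnits)
    (hz : z ∈ slice Ω I) : conj z ∈ slice Ω I := by
  change slicePoint I (conj z) ∈ Ω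
  rw [slicePoint_conj]
  exact hsymm z.re z.im I hI hz (slicePoint_mem_sphere (neg_mem_imagUnits hI) z)

theorem IsSliceDomain.exists_ofReal_mem_slice (hΩ : IsSliceDomain Ω) (I : ℍ[ℝ]) :
    ∃ x : ℝ, (x : ℂ) ∈ slice Ω I := by
  obtain ⟨x, hx⟩ := hΩ.2.1
  exact ⟨x, by simpa [slice, slicePoint] using hx⟩

theorem slicePoint_mem_degenerateSet {f : ℍ[ℝ] → ℍ[ℝ]} (hsymm : IsSymmetric Ω)
    (hI : I ∈ imagUnits) (hz : z ∈ slice Ω I) (him : z.im ≠ 0) {c : ℍ[ℝ]}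
    (hconst : ∀ J ∈ imagUnits, f (slicePoint J z) = c) :
    slicePoint I z ∈ degenerateSet f Ω := by
  refine ⟨z.re, z.im, him, hsymm _ _ I hI hz, ⟨c, ?_⟩, slicePoint_mem_sphere hI z⟩
  rintro _ ⟨J, hJ, rfl⟩
  exact hconst J hJ

theorem dense_compl_range_coe : Dense (range ((↑) : ℝ → ℍ[ℝ]))ᶜ :=
  (Algebra.linearMap ℝ ℍ[ℝ]).toContinuousLinearMap.contDiff.dense_compl_range_of_finrank_lt_finrank
    (by rw [Module.finrank_self, Quaternion.finrank_eq_four]; norm_num)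

theorem subset_closure_degenerateSet_of_eqOn_const {f : ℍ[ℝ] → ℍ[ℝ]} (hΩ : IsOpen Ω)
    (hsymm : IsSymmetric Ω) {c : ℍ[ℝ]} (hconst : ∀ q ∈ Ω, f q = c) :
    Ω ⊆ closure (degenerateSet f Ω) := by
  refine (dense_compl_range_coe.open_subset_closure_inter hΩ).trans (closure_mono ?_)
  rintro q ⟨hq, hnonreal⟩
  obtain ⟨I, hI, z, rfl⟩ := exists_eq_slicePoint q
  refine slicePoint_mem_degenerateSet (c := c) hsymm hI hq
    (fun him => hnonreal ⟨z.re, (slicePoint_of_im_eq_zero I him).symm⟩) fun J hJ => ?_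
  exact hconst _ (hsymm z.re z.im I hI hq (slicePoint_mem_sphere hJ z))

end Symmetric

/-! ### Holomorphy with respect to left multiplication by an imaginary unit -/

/-- The real-linear functional on the quaternions with real part `⟪v, ·⟫` that turns left
multiplication by the imaginary unit `I` into multiplication by `i`. -/
noncomputable def sliceFunctional (I v : ℍ[ℝ]) : ℍ[ℝ] →L[ℝ] ℂ :=
  Complex.ofRealCLM.comp (innerSL ℝ v) + Complex.I • Complex.ofRealCLM.comp (innerSL ℝ (I * v))

theorem sliceFunctional_apply (I v q : ℍ[ℝ]) :
    sliceFunctional I v q = (⟪q, v⟫ : ℂ) + (⟪q, I * v⟫ : ℂ) * Complex.I := by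
  simp [sliceFunctional, real_inner_comm, mul_comm]

theorem sliceFunctional_mul {I : ℍ[ℝ]} (hI : I ∈ imagUnits) (v q : ℍ[ℝ]) :
    sliceFunctional I v (I * q) = Complex.I * sliceFunctional I v q := by
  rw [sliceFunctional_apply, sliceFunctional_apply, inner_mul_left_of_mem_imagUnits hI,
    inner_mul_mul_of_mem_imagUnits hI]
  push_cast
  linear_combination -(⟪q, I * v⟫ : ℂ) * Complex.I_mul_I

theorem eq_of_forall_sliceFunctional_eq {I p q : ℍ[ℝ]}
    (h : ∀ v, sliceFunctional I v p = sliceFunctional I v q) : p = q := by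
  refine ext_inner_right ℝ fun v => ?_
  simpa [sliceFunctional_apply] using congrArg Complex.re (h v)

/-- Holomorphy of a quaternion-valued function for the complex structure on `ℍ` given by left
multiplication by `I`, tested on the `I`-linear functionals `sliceFunctional I v` so that `ℍ` need
not carry a complex vector space structure depending on `I`. -/
def LeftHolomorphicOn (I : ℍ[ℝ]) (F : ℂ → ℍ[ℝ]) (U : Set ℂ) : Prop :=
  ∀ v, DifferentiableOn ℂ (fun z => sliceFunctional I v (F z)) U

theorem leftHolomorphicOn_const (I w : ℍ[ℝ]) (U : Set ℂ) : LeftHolomorphicOn I (fun _ => w) U :=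
  fun _ => differentiableOn_const _

theorem IsRegularOn.leftHolomorphicOn {f : ℍ[ℝ] → ℍ[ℝ]} {Ω : Set ℍ[ℝ]} (hf : IsRegularOn f Ω)
    (hΩ : IsOpen Ω) {I : ℍ[ℝ]} (hI : I ∈ imagUnits) :
    LeftHolomorphicOn I (sliceFun f I) (slice Ω I) := by
  intro v z hz
  obtain ⟨hC1, hdbar⟩ := hf I hI
  have hdiff : DifferentiableAt ℝ (sliceFun f I) z :=
    (hC1.contDiffAt ((isOpen_slice hΩ I).mem_nhds hz)).differentiableAt one_ne_zero
  have cauchyRiemann :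
      fderiv ℝ (sliceFun f I) z Complex.I = I * fderiv ℝ (sliceFun f I) z 1 := by
    have h := hdbar z hz
    rw [dbar, smul_eq_zero_iff_right (by norm_num)] at h
    rw [eq_neg_of_add_eq_zero_left h, mul_neg, mul_mul_of_mem_imagUnits hI, neg_neg]
  have hcomp : HasFDerivAt (fun z => sliceFunctional I v (sliceFun f I z))
      ((sliceFunctional I v).comp (fderiv ℝ (sliceFun f I) z)) z :=
    (sliceFunctional I v).hasFDerivAt.comp z hdiff.hasFDerivAt
  refine (differentiableAt_complex_iff_differentiableAt_real.2
    ⟨hcomp.differentiableAt, ?_⟩).differentiableWithinAt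
  rw [hcomp.fderiv, ContinuousLinearMap.comp_apply, ContinuousLinearMap.comp_apply, cauchyRiemann,
    sliceFunctional_mul hI, smul_eq_mul]

/-! ### The identity principle -/

theorem frequently_im_eq_zero (x : ℝ) : ∃ᶠ z in 𝓝[≠] (x : ℂ), z.im = 0 := by
  have htendsto : Tendsto (fun t : ℝ => (t : ℂ)) (𝓝[≠] x) (𝓝[≠] (x : ℂ)) :=
    Complex.continuous_ofReal.continuousWithinAt.tendsto_nhdsWithin
      fun _ ht => Complex.ofReal_injective.ne ht
  exact htendsto.frequently (Frequently.of_forall Complex.ofReal_im)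

theorem eqOn_of_eq_of_im_eq_zero {E : Type*} [NormedAddCommGroup E] [NormedSpace ℂ E]
    [CompleteSpace E] {U : Set ℂ} (hU : IsOpen U) (hUc : IsPreconnected U) {x : ℝ}
    (hx : (x : ℂ) ∈ U) {g h : ℂ → E} (hg : DifferentiableOn ℂ g U) (hh : DifferentiableOn ℂ h U)
    (heq : ∀ z ∈ U, z.im = 0 → g z = h z) : EqOn g h U := by
  refine (hg.analyticOnNhd hU).eqOn_of_preconnected_of_frequently_eq (hh.analyticOnNhd hU) hUc hx ?_
  have hmem : ∀ᶠ z in 𝓝[≠] (x : ℂ), z ∈ U := nhdsWithin_le_nhds (hU.mem_nhds hx)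
  exact ((frequently_im_eq_zero x).and_eventually hmem).mono fun z hz => heq z hz.2 hz.1

theorem LeftHolomorphicOn.eqOn_slice {Ω : Set ℍ[ℝ]} (hΩ : IsSliceDomain Ω) {I : ℍ[ℝ]}
    (hI : I ∈ imagUnits) {F G : ℂ → ℍ[ℝ]} (hF : LeftHolomorphicOn I F (slice Ω I))
    (hG : LeftHolomorphicOn I G (slice Ω I)) (heq : ∀ z ∈ slice Ω I, z.im = 0 → F z = G z) :
    EqOn F G (slice Ω I) := by
  obtain ⟨x, hx⟩ := hΩ.exists_ofReal_mem_slice I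
  obtain ⟨hopen, hconn⟩ := hΩ.2.2 I hI
  exact fun z hz => eq_of_forall_sliceFunctional_eq (I := I) fun v =>
    eqOn_of_eq_of_im_eq_zero hopen hconn.isPreconnected hx (hF v) (hG v)
      (fun u hu him => by rw [heq u hu him]) hz

/-! ### The stem function and the representation formula -/

section Stem

variable (f : ℍ[ℝ] → ℍ[ℝ]) (I : ℍ[ℝ])

/-- The term `α` in the decomposition `f (x + yJ) = α z + J * β z` of a regular function on the
sphere of `z = x + iy`, computed from the values of `f` at `x + yI` and `x - yI`. -/
noncomputable def stemRe (z : ℂ) : ℍ[ℝ] :=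
  (1 / 2 : ℝ) • (sliceFun f I z + sliceFun f I (conj z))

/-- The coefficient `β` in the decomposition `f (x + yJ) = α z + J * β z` of a regular function on
the sphere of `z = x + iy`, computed from the values of `f` at `x + yI` and `x - yI`. -/
noncomputable def stemIm (z : ℂ) : ℍ[ℝ] :=
  (1 / 2 : ℝ) • (I * (sliceFun f I (conj z) - sliceFun f I z))

/-- The `v`-component of the stem function `stemRe + i stemIm`, which takes values in the
complexification of `ℍ`. -/
noncomputable def stemComp (v : ℍ[ℝ]) (z : ℂ) : ℂ :=
  (⟪stemRe f I z, v⟫ : ℂ) + (⟪stemIm f I z, v⟫ : ℂ) * Complex.I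

variable {I} {z : ℂ}

theorem stemRe_of_im_eq_zero (him : z.im = 0) : stemRe f I z = f z.re := by
  rw [stemRe, Complex.conj_eq_iff_im.2 him, ← two_smul ℝ, smul_smul, one_div_mul_cancel two_ne_zero,
    one_smul, sliceFun, slicePoint_of_im_eq_zero I him]

theorem stemIm_of_im_eq_zero (him : z.im = 0) : stemIm f I z = 0 := by
  rw [stemIm, Complex.conj_eq_iff_im.2 him, sub_self, mul_zero, smul_zero]

theorem stemComp_eq (hI : I ∈ imagUnits) (v : ℍ[ℝ]) (z : ℂ) :
    stemComp f I v z = 1 / 2 * (sliceFunctional I v (sliceFun f I z)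
      + conj (sliceFunctional I v (sliceFun f I (conj z)))) := by
  simp only [stemComp, stemRe, stemIm, sliceFunctional_apply, real_inner_smul_left, inner_add_left,
    inner_mul_left_of_mem_imagUnits hI, inner_sub_left, map_add, map_mul, Complex.conj_ofReal,
    Complex.conj_I]
  push_cast
  ring

theorem sliceFunctional_stem {J : ℍ[ℝ]} (hJ : J ∈ imagUnits) (v : ℍ[ℝ]) (z : ℂ) :
    sliceFunctional J v (stemRe f I z + J * stemIm f I z)
      = stemComp f I v z + Complex.I * stemComp f I (J * v) z := by
  simp only [sliceFunctional_apply, stemComp, inner_add_left, inner_mul_left_of_mem_imagUnits hJ,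
    mul_mul_of_mem_imagUnits hJ, inner_neg_right]
  push_cast
  linear_combination -(⟪stemIm f I z, J * v⟫ : ℂ) * Complex.I_mul_I

variable {f} {Ω : Set ℍ[ℝ]}

theorem differentiableOn_stemComp (hΩ : IsOpen Ω) (hsymm : IsSymmetric Ω) (hf : IsRegularOn f Ω)
    (hI : I ∈ imagUnits) (v : ℍ[ℝ]) : DifferentiableOn ℂ (stemComp f I v) (slice Ω I) := by
  have hhol := hf.leftHolomorphicOn hΩ hI v
  have hopen := isOpen_slice hΩ I
  intro z hz
  have hz_diff := hhol.differentiableAt (hopen.mem_nhds hz)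
  have hconj_diff :=
    (hhol.differentiableAt (hopen.mem_nhds (hsymm.conj_mem_slice hI hz))).conj_conj
  rw [Complex.conj_conj] at hconj_diff
  rw [funext (stemComp_eq f hI v)]
  exact ((hz_diff.add hconj_diff).const_mul (1 / 2)).differentiableWithinAt

theorem continuousAt_stemRe_stemIm (hΩ : IsOpen Ω) (hsymm : IsSymmetric Ω) (hf : IsRegularOn f Ω)
    (hI : I ∈ imagUnits) (hz : z ∈ slice Ω I) :
    ContinuousAt (stemRe f I) z ∧ ContinuousAt (stemIm f I) z := by
  have hcont : ∀ u ∈ slice Ω I, ContinuousAt (sliceFun f I) u := fun u hu =>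
    (hf I hI).1.continuousOn.continuousAt ((isOpen_slice hΩ I).mem_nhds hu)
  have hconj : ContinuousAt (fun u => sliceFun f I (conj u)) z :=
    ContinuousAt.comp (f := fun u : ℂ => conj u) (hcont _ (hsymm.conj_mem_slice hI hz))
      Complex.continuous_conj.continuousAt
  exact ⟨((hcont z hz).add hconj).const_smul (1 / 2 : ℝ),
    (continuousAt_const.mul (hconj.sub (hcont z hz))).const_smul (1 / 2 : ℝ)⟩

theorem representation_formula (hΩ : IsSliceDomain Ω) (hsymm : IsSymmetric Ω)
    (hf : IsRegularOn f Ω) (hI : I ∈ imagUnits) {J : ℍ[ℝ]} (hJ : J ∈ imagUnits)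
    (hz : z ∈ slice Ω I) : f (slicePoint J z) = stemRe f I z + J * stemIm f I z := by
  have hstem : LeftHolomorphicOn J (fun u => stemRe f I u + J * stemIm f I u) (slice Ω J) := by
    intro v
    simp only [sliceFunctional_stem f hJ]
    rw [hsymm.slice_eq hJ hI]
    exact (differentiableOn_stemComp hΩ.1.1 hsymm hf hI v).add
      ((differentiableOn_stemComp hΩ.1.1 hsymm hf hI (J * v)).const_mul _)
  refine (hf.leftHolomorphicOn hΩ.1.1 hJ).eqOn_slice hΩ hJ hstem (fun u _ him => ?_)
    (hsymm.slice_eq hI hJ ▸ hz)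
  rw [stemRe_of_im_eq_zero f him, stemIm_of_im_eq_zero f him, mul_zero, add_zero, sliceFun,
    slicePoint_of_im_eq_zero J him]

end Stem

/-! ### The symmetrization -/

section ComplexNormSq

variable {E : Type*} [NormedAddCommGroup E] [InnerProductSpace ℝ E]

/-- The value at `a + ib` of the complex quadratic form extending `‖·‖ ^ 2` to the complexification
of a real inner product space. -/
noncomputable def complexNormSq (a b : E) : ℂ :=
  ⟨‖a‖ ^ 2 - ‖b‖ ^ 2, 2 * ⟪a, b⟫⟩

theorem complexNormSq_eq_zero_iff {a b : E} : complexNormSq a b = 0 ↔ ‖a‖ = ‖b‖ ∧ ⟪a, b⟫ = 0 := by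
  simp [complexNormSq, Complex.ext_iff, sub_eq_zero]

theorem continuous_complexNormSq : Continuous fun p : E × E => complexNormSq p.1 p.2 := by
  simp only [complexNormSq, Complex.mk_eq_add_mul_I]
  fun_prop

theorem complexNormSq_eq_sum {ι : Type*} [Fintype ι] (e : OrthonormalBasis ι ℝ E) (a b : E) :
    complexNormSq a b = ∑ k, ((⟪a, e k⟫ : ℂ) + (⟪b, e k⟫ : ℂ) * Complex.I) ^ 2 := by
  rw [complexNormSq, ← e.sum_sq_inner_left a, ← e.sum_sq_inner_left b, ← e.sum_inner_mul_inner a b,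
    ← Finset.sum_sub_distrib, Finset.mul_sum, Complex.mk_eq_add_mul_I]
  push_cast
  rw [Finset.sum_mul, ← Finset.sum_add_distrib]
  refine Finset.sum_congr rfl fun k _ => ?_
  rw [real_inner_comm b]
  linear_combination -(⟪b, e k⟫ : ℂ) ^ 2 * Complex.I_sq

end ComplexNormSq

theorem complexNormSq_eq_zero_iff_exists_imagUnit {a b : ℍ[ℝ]} :
    complexNormSq a b = 0 ↔ ∃ J ∈ imagUnits, a + J * b = 0 := by
  rw [complexNormSq_eq_zero_iff]
  constructor
  · rintro ⟨hnorm, horth⟩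
    by_cases hb : b = 0
    · obtain ⟨J, hJ⟩ := imagUnits_nonempty
      have ha : a = 0 := by rwa [hb, norm_zero, norm_eq_zero] at hnorm
      exact ⟨J, hJ, by rw [ha, hb, mul_zero, add_zero]⟩
    · refine ⟨-(a * b⁻¹), neg_mem_imagUnits (mul_inv_mem_imagUnits hb hnorm horth), ?_⟩
      rw [neg_mul, inv_mul_cancel_right₀ hb, add_neg_cancel]
  · rintro ⟨J, hJ, h⟩
    rw [eq_neg_of_add_eq_zero_left h, norm_neg, norm_mul, norm_eq_one_of_mem_imagUnits hJ, one_mul,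
      inner_neg_left, inner_mul_self_of_mem_imagUnits hJ, neg_zero]
    exact ⟨rfl, rfl⟩

/-- The symmetrization of `f - w`, read in the complex plane: the complex square norm of its stem
function. It vanishes at `z` exactly when `f` takes the value `w` somewhere on the sphere of `z`. -/
noncomputable def symmetrization (f : ℍ[ℝ] → ℍ[ℝ]) (I w : ℍ[ℝ]) (z : ℂ) : ℂ :=
  complexNormSq (stemRe f I z - w) (stemIm f I z)

section Symmetrization

variable {f : ℍ[ℝ] → ℍ[ℝ]} {Ω : Set ℍ[ℝ]} {I : ℍ[ℝ]} {z : ℂ}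

theorem symmetrization_eq_zero_iff (hΩ : IsSliceDomain Ω) (hsymm : IsSymmetric Ω)
    (hf : IsRegularOn f Ω) (hI : I ∈ imagUnits) (hz : z ∈ slice Ω I) {w : ℍ[ℝ]} :
    symmetrization f I w z = 0 ↔ ∃ J ∈ imagUnits, f (slicePoint J z) = w := by
  rw [symmetrization, complexNormSq_eq_zero_iff_exists_imagUnit]
  refine exists_congr fun J => and_congr_right fun hJ => ?_
  rw [representation_formula hΩ hsymm hf hI hJ hz, sub_add_eq_add_sub, sub_eq_zero]

theorem differentiableOn_symmetrization (hΩ : IsOpen Ω) (hsymm : IsSymmetric Ω)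
    (hf : IsRegularOn f Ω) (hI : I ∈ imagUnits) (w : ℍ[ℝ]) :
    DifferentiableOn ℂ (symmetrization f I w) (slice Ω I) := by
  let e := stdOrthonormalBasis ℝ ℍ[ℝ]
  have hsum : symmetrization f I w = fun z => ∑ k, (stemComp f I (e k) z - (⟪w, e k⟫ : ℂ)) ^ 2 := by
    funext z
    rw [symmetrization, complexNormSq_eq_sum e]
    refine Finset.sum_congr rfl fun k _ => ?_
    rw [stemComp, inner_sub_left]
    push_cast
    ring
  rw [hsum]
  exact DifferentiableOn.fun_sum fun k _ =>
    ((differentiableOn_stemComp hΩ hsymm hf hI (e k)).sub_const _).pow 2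

theorem continuousAt_symmetrization (hΩ : IsOpen Ω) (hsymm : IsSymmetric Ω) (hf : IsRegularOn f Ω)
    (hI : I ∈ imagUnits) (hz : z ∈ slice Ω I) (w : ℍ[ℝ]) :
    ContinuousAt (fun p : ℍ[ℝ] × ℂ => symmetrization f I p.1 p.2) (w, z) := by
  obtain ⟨hRe, hIm⟩ := continuousAt_stemRe_stemIm hΩ hsymm hf hI hz
  have hpair : ContinuousAt
      (fun p : ℍ[ℝ] × ℂ => (stemRe f I p.2 - p.1, stemIm f I p.2)) (w, z) :=
    ((hRe.comp' continuousAt_snd).sub continuousAt_fst).prodMk (hIm.comp' continuousAt_snd)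
  exact continuous_complexNormSq.continuousAt.comp' hpair

theorem eq_of_symmetrization_eventually_eq_zero (hΩ : IsSliceDomain Ω) (hsymm : IsSymmetric Ω)
    (hf : IsRegularOn f Ω) (hI : I ∈ imagUnits) (hz : z ∈ slice Ω I) {w : ℍ[ℝ]}
    (hzero : ∀ᶠ u in 𝓝 z, symmetrization f I w u = 0) {q : ℍ[ℝ]} (hq : q ∈ Ω) : f q = w := by
  obtain ⟨hopen, hconn⟩ := hΩ.2.2 I hI
  have hvanish : EqOn (symmetrization f I w) (fun _ => 0) (slice Ω I) :=
    ((differentiableOn_symmetrization hΩ.1.1 hsymm hf hI w).analyticOnNhd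
      hopen).eqOn_of_preconnected_of_eventuallyEq analyticOnNhd_const hconn.isPreconnected hz hzero
  have hreal : ∀ u ∈ slice Ω I, u.im = 0 → f u.re = w := fun u hu him => by
    obtain ⟨J, -, hJ⟩ := (symmetrization_eq_zero_iff hΩ hsymm hf hI hu).1 (hvanish hu)
    rwa [slicePoint_of_im_eq_zero J him] at hJ
  obtain ⟨J, hJ, u, rfl⟩ := exists_eq_slicePoint q
  refine (hf.leftHolomorphicOn hΩ.1.1 hJ).eqOn_slice hΩ hJ (leftHolomorphicOn_const J w _)
    (fun t ht him => ?_) hq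
  rw [sliceFun, slicePoint_of_im_eq_zero J him]
  exact hreal t (hsymm.slice_eq hJ hI ▸ ht) him

end Symmetrization

/-! ### Persistence of zeros -/

theorem exists_eq_zero_of_norm_lt_frontier {E : Type*} [NormedAddCommGroup E] [NormedSpace ℂ E]
    [FiniteDimensional ℂ E] [Nontrivial E] {U : Set E} (hU : Bornology.IsBounded U) {g : E → ℂ}
    (hg : DiffContOnCl ℂ g U) {z₀ : E} (hz₀ : z₀ ∈ U) (hlt : ∀ z ∈ frontier U, ‖g z₀‖ < ‖g z‖) :
    ∃ z ∈ U, g z = 0 := by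
  by_contra! hne
  have hne_closure : ∀ z ∈ closure U, g z ≠ 0 := by
    rw [closure_eq_self_union_frontier]
    rintro z (hz | hz)
    · exact hne z hz
    · exact norm_pos_iff.1 ((norm_nonneg _).trans_lt (hlt z hz))
  obtain ⟨z, hz, hmax⟩ :=
    Complex.exists_mem_frontier_isMaxOn_norm hU ⟨z₀, hz₀⟩ (hg.inv hne_closure)
  have hinv : ‖(g z₀)⁻¹‖ ≤ ‖(g z)⁻¹‖ := hmax (subset_closure hz₀)
  rw [norm_inv, norm_inv, inv_le_inv₀ (norm_pos_iff.2 (hne z₀ hz₀))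
    (norm_pos_iff.2 (hne_closure z (frontier_subset_closure hz)))] at hinv
  exact hinv.not_gt (hlt z hz)

theorem eventually_exists_eq_zero_of_isolated_zero {X : Type*} [TopologicalSpace X]
    {N : X → ℂ → ℂ} {w₀ : X} {z₀ : ℂ} {V : Set ℂ} (hV : V ∈ 𝓝 z₀)
    (hdiff : ∀ w, DifferentiableOn ℂ (N w) V)
    (hcont : ∀ z ∈ V, ContinuousAt (fun p : X × ℂ => N p.1 p.2) (w₀, z)) (hzero : N w₀ z₀ = 0)
    (hisolated : ∀ᶠ z in 𝓝[≠] z₀, N w₀ z ≠ 0) :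
    ∀ᶠ w in 𝓝 w₀, ∃ z ∈ V, N w z = 0 := by
  rw [eventually_nhdsWithin_iff] at hisolated
  obtain ⟨r, hr, hball⟩ := Metric.nhds_basis_closedBall.mem_iff.1 (inter_mem hisolated hV)
  have hballV : Metric.closedBall z₀ r ⊆ V := fun z hz => (hball hz).2
  have hlt : ∀ᶠ w in 𝓝 w₀, ∀ z ∈ Metric.sphere z₀ r, ‖N w z₀‖ < ‖N w z‖ := by
    refine (isCompact_sphere z₀ r).eventually_forall_of_forall_eventually
      (P := fun w z => ‖N w z₀‖ < ‖N w z‖) fun z hz => ?_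
    have hz_mem : z ∈ Metric.closedBall z₀ r := Metric.sphere_subset_closedBall hz
    have hcenter : ContinuousAt (fun p : X × ℂ => N p.1 z₀) (w₀, z) :=
      ContinuousAt.comp' (g := fun p : X × ℂ => N p.1 p.2) (f := fun p : X × ℂ => (p.1, z₀))
        (hcont z₀ (mem_of_mem_nhds hV)) (by fun_prop)
    refine hcenter.norm.eventually_lt (hcont z (hballV hz_mem)).norm ?_
    simpa only [hzero, norm_zero, norm_pos_iff] using
      (hball hz_mem).1 (Metric.ne_of_mem_sphere hz hr.ne')
  filter_upwards [hlt] with w hw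
  obtain ⟨z, hz, hNz⟩ := exists_eq_zero_of_norm_lt_frontier Metric.isBounded_ball
    ((hdiff w).diffContOnCl_ball hballV) (Metric.mem_ball_self hr)
    (fun z hz => hw z (Metric.frontier_ball_subset_sphere hz))
  exact ⟨z, hballV (Metric.ball_subset_closedBall hz), hNz⟩

/-! ### Local openness -/

section Openness

variable {f : ℍ[ℝ] → ℍ[ℝ]} {Ω : Set ℍ[ℝ]} {I : ℍ[ℝ]} {z₀ : ℂ}

theorem eventually_exists_eq_on_sphere (hΩ : IsSliceDomain Ω) (hsymm : IsSymmetric Ω)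
    (hf : IsRegularOn f Ω) (hI : I ∈ imagUnits) (hz₀ : z₀ ∈ slice Ω I)
    (hne : ∃ p ∈ Ω, f p ≠ f (slicePoint I z₀)) {V : Set ℂ} (hV : V ∈ 𝓝 z₀) :
    ∀ᶠ w in 𝓝 (f (slicePoint I z₀)), ∃ z ∈ V, ∃ J ∈ imagUnits, f (slicePoint J z) = w := by
  have hopen := isOpen_slice hΩ.1.1 I
  have hdiff := differentiableOn_symmetrization hΩ.1.1 hsymm hf hI
  have hisolated : ∀ᶠ z in 𝓝[≠] z₀, symmetrization f I (f (slicePoint I z₀)) z ≠ 0 := by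
    refine ((hdiff _).analyticAt
      (hopen.mem_nhds hz₀)).eventually_eq_zero_or_eventually_ne_zero.resolve_left fun hev => ?_
    obtain ⟨p, hp, hpne⟩ := hne
    exact hpne (eq_of_symmetrization_eventually_eq_zero hΩ hsymm hf hI hz₀ hev hp)
  filter_upwards [eventually_exists_eq_zero_of_isolated_zero
    (inter_mem (hopen.mem_nhds hz₀) hV) (fun w => (hdiff w).mono inter_subset_left)
    (fun z hz => continuousAt_symmetrization hΩ.1.1 hsymm hf hI hz.1 _)
    ((symmetrization_eq_zero_iff hΩ hsymm hf hI hz₀).2 ⟨I, hI, rfl⟩) hisolated]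
    with w ⟨z, hz, hzero⟩
  exact ⟨z, hz.2, (symmetrization_eq_zero_iff hΩ hsymm hf hI hz.1).1 hzero⟩

theorem eventually_forall_mem_of_eq {X Y Z M : Type*} [TopologicalSpace X] [TopologicalSpace Y]
    [TopologicalSpace Z] [T2Space Z] [TopologicalSpace M] {K : Set Y} (hK : IsCompact K)
    {φ ψ : X × Y → Z} {π : X × Y → M} {x₀ : X} {T : Set M}
    (hφ : ∀ y ∈ K, ContinuousAt φ (x₀, y)) (hψ : ∀ y ∈ K, ContinuousAt ψ (x₀, y))
    (hπ : ∀ y ∈ K, ContinuousAt π (x₀, y))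
    (hT : ∀ y ∈ K, φ (x₀, y) = ψ (x₀, y) → T ∈ 𝓝 (π (x₀, y))) :
    ∀ᶠ x in 𝓝 x₀, ∀ y ∈ K, φ (x, y) = ψ (x, y) → π (x, y) ∈ T := by
  refine hK.eventually_forall_of_forall_eventually
    (P := fun x y => φ (x, y) = ψ (x, y) → π (x, y) ∈ T) fun y hy => ?_
  by_cases heq : φ (x₀, y) = ψ (x₀, y)
  · exact ((hπ y hy).eventually_mem (hT y hy heq)).mono fun _ hmem _ => hmem
  · exact (((hφ y hy).ne_iff_eventually_ne (hψ y hy)).1 heq).mono fun _ hne heq => absurd heq hne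

theorem eventually_slicePoint_mem_of_eq (hΩ : IsSliceDomain Ω) (hsymm : IsSymmetric Ω)
    (hf : IsRegularOn f Ω) (hI : I ∈ imagUnits) (hz₀ : z₀ ∈ slice Ω I) {w₀ : ℍ[ℝ]} {T : Set ℍ[ℝ]}
    (hT : ∀ J ∈ imagUnits, f (slicePoint J z₀) = w₀ → T ∈ 𝓝 (slicePoint J z₀)) :
    ∀ᶠ p : ℍ[ℝ] × ℂ in 𝓝 (w₀, z₀),
      ∀ J ∈ imagUnits, f (slicePoint J p.2) = p.1 → slicePoint J p.2 ∈ T := by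
  obtain ⟨hRe, hIm⟩ := continuousAt_stemRe_stemIm hΩ.1.1 hsymm hf hI hz₀
  have hstem : ∀ᶠ p : ℍ[ℝ] × ℂ in 𝓝 (w₀, z₀),
      ∀ J ∈ imagUnits, stemRe f I p.2 + J * stemIm f I p.2 = p.1 → slicePoint J p.2 ∈ T := by
    refine eventually_forall_mem_of_eq isCompact_imagUnits
      (φ := fun r : (ℍ[ℝ] × ℂ) × ℍ[ℝ] => stemRe f I r.1.2 + r.2 * stemIm f I r.1.2)
      (ψ := fun r => r.1.1) (π := fun r => slicePoint r.2 r.1.2) (fun J _ => ?_)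
      (fun _ _ => continuousAt_fst.fst) (fun _ _ => ?_) (fun J hJ hval => hT J hJ ?_)
    · exact (hRe.comp' continuousAt_fst.snd).add
        (continuousAt_snd.mul (hIm.comp' continuousAt_fst.snd))
    · exact continuous_slicePoint.continuousAt.comp' (continuousAt_snd.prodMk continuousAt_fst.snd)
    · exact (representation_formula hΩ hsymm hf hI hJ hz₀).trans hval
  have hslice : ∀ᶠ p : ℍ[ℝ] × ℂ in 𝓝 (w₀, z₀), p.2 ∈ slice Ω I :=
    continuousAt_snd.eventually_mem ((isOpen_slice hΩ.1.1 I).mem_nhds hz₀)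
  filter_upwards [hstem, hslice] with p hp hpΩ J hJ hval
  exact hp J hJ ((representation_formula hΩ hsymm hf hI hJ hpΩ).symm.trans hval)

theorem slicePoint_eq_of_notMem_degenerateSet (hΩ : IsSliceDomain Ω) (hsymm : IsSymmetric Ω)
    (hf : IsRegularOn f Ω) (hI : I ∈ imagUnits) (hz₀ : z₀ ∈ slice Ω I)
    (hdeg : slicePoint I z₀ ∉ degenerateSet f Ω) {J : ℍ[ℝ]} (hJ : J ∈ imagUnits)
    (hval : f (slicePoint J z₀) = f (slicePoint I z₀)) : slicePoint J z₀ = slicePoint I z₀ := by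
  by_cases him : z₀.im = 0
  · rw [slicePoint_of_im_eq_zero J him, slicePoint_of_im_eq_zero I him]
  have hrep {K : ℍ[ℝ]} (hK : K ∈ imagUnits) := representation_formula hΩ hsymm hf hI hK hz₀
  have hstemIm : stemIm f I z₀ ≠ 0 := fun h =>
    hdeg (slicePoint_mem_degenerateSet hsymm hI hz₀ him fun K hK => by
      rw [hrep hK, h, mul_zero, add_zero])
  rw [hrep hJ, hrep hI, add_right_inj, mul_left_inj' hstemIm] at hval
  rw [hval]

theorem IsRegularOn.nhds_le_map_nhds (hf : IsRegularOn f Ω) (hΩ : IsSliceDomain Ω)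
    (hsymm : IsSymmetric Ω) {q : ℍ[ℝ]} (hq : q ∈ Ω) (hdeg : q ∉ degenerateSet f Ω)
    (hne : ∃ p ∈ Ω, f p ≠ f q) : 𝓝 (f q) ≤ map f (𝓝 q) := by
  obtain ⟨I, hI, z₀, rfl⟩ := exists_eq_slicePoint q
  intro S hS
  have hclose := eventually_slicePoint_mem_of_eq hΩ hsymm hf hI hq fun J hJ hval => by
    rw [slicePoint_eq_of_notMem_degenerateSet hΩ hsymm hf hI hq hdeg hJ hval]
    exact mem_map.1 hS
  rw [nhds_prod_eq] at hclose
  obtain ⟨W, hW, V, hV, hWV⟩ := eventually_prod_iff.1 hclose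
  filter_upwards [hW, eventually_exists_eq_on_sphere hΩ hsymm hf hI hq hne hV]
    with w hw ⟨z, hz, J, hJ, hval⟩
  rw [← hval]
  exact hWV hw hz J hJ hval

end Openness

end SliceRegular

theorem mainTheorem5 (Ω : Set ℍ[ℝ]) (hΩ : SliceRegular.IsSliceDomain Ω)
    (hsymm : SliceRegular.IsSymmetric Ω) (f : ℍ[ℝ] → ℍ[ℝ])
    (hf : SliceRegular.IsRegularOn f Ω) :
    IsOpenMap ((Ω \ closure (SliceRegular.degenerateSet f Ω)).domRestrict f) := by
  have hopen : IsOpen (Ω \ closure (SliceRegular.degenerateSet f Ω)) :=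
    hΩ.1.1.sdiff isClosed_closure
  refine IsOpenMap.of_nhds_le ?_
  rintro ⟨q, hq, hdeg⟩
  have hne : ∃ p ∈ Ω, f p ≠ f q := by
    by_contra! hconst
    exact hdeg (SliceRegular.subset_closure_degenerateSet_of_eqOn_const hΩ.1.1 hsymm hconst hq)
  calc 𝓝 (f q) ≤ map f (𝓝 q) :=
        hf.nhds_le_map_nhds hΩ hsymm hq (fun h => hdeg (subset_closure h)) hne
    _ = map _ (𝓝 (⟨q, hq, hdeg⟩ : ↥(Ω \ closure (SliceRegular.degenerateSet f Ω)))) := by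
        rw [← map_nhds_subtype_coe_eq_nhds ⟨hq, hdeg⟩ (hopen.mem_nhds ⟨hq, hdeg⟩), map_map]
        rfl
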